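/- Let $G$ be a finite connected weighted graph with vertex set $V$ and weights $w_{xy}=w_{yx}\ge 0$, where $x\sim y$ if and only if $w_{xy}>0$ (loops allowed). Put $d_x=\sum_y w_{xy}$, $m_x=\frac1{d_x}\sum_{y\sim x}w_{xy}\delta_y$, $\nu(A)=\sum_{x\in A}d_x$, and $$TV(u)=\frac12\int_V\int_V|u(y)-u(x)|\,dm_x(y)\,d\nu(x),\qquad \nu(u)=\frac1{\nu(V)}\int_V u\,d\nu .$$ (a) $G$ satisfies a $2$-Poincaré inequality: there is $c>0$ with $$\|u\|_{L^2(V,\nu)}\le c\left(\int_V\int_V|u(y)-u(x)|\,dm_x(y)\,d\nu(x)+\left|\int_V u\,d\nu\right|\right)\quad\text{for all } u:V\to\mathbb R,$$ and $$\lambda^2:=\inf\left\{\frac{TV(u)}{\|u\|_{L^2(V,\nu)}}:\ \|u\|_{L^2(V,\nu)}\neq0,\ \int_V u\,d\nu=0\right\}>0$$ (here the superscript $2$ refers to $L^2$ and is not a square; $\lambda^2=+\infty$ if the set is empty, which happens only when $G$ has at most one vertex, and then $a/\infty=0$ and $\infty\cdot 0=0$). (b) Let $\Delta_1$ be the multivalued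 operator on $L^2(V,\nu)$ given by $v\in\Delta_1u$ if and only if $-v\in\partial TV(u)$, the subdifferential being taken in $L^2(V,\nu)$. For each $u_0\in L^2(V,\nu)$ let $t\mapsto e^{t\Delta_1}u_0$, $t\ge0$, be the total variation flow, that is, the function $u$ with $u(0)=u_0$ which for every $T>0$ is the unique one (on $[0,T]$) such that $u\in W^{1,1}(0,T;L^2(V,\nu))$, $u(0)=u_0$ and $u'(t)\in\Delta_1u(t)$ for almost every $t\in(0,T)$; this function exists and is unique. With $\hat t:=\|u_0-\nu(u_0)\|_{L^2(V,\nu)}/\lambda^2$, $$\|e^{t\Delta_1}u_0-\nu(u_0)\|_{L^2(V,\nu)}\le\lambda^2\,(\hat t-t)^+\quad\text{for all } t\ge0,$$ and consequently $e^{t\Delta_1}u_0=\nu(u_0)$ for all $t\ge\hat t$. -/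

import Mathlib

open MeasureTheory Set
open scoped ENNReal

noncomputable section

/-- A weighted graph with vertex set `V`: symmetric nonnegative weights; the edges are the pairs of
positive weight (loops are allowed). -/
structure WeightedGraph (V : Type*) where
  weight : V → V → ℝ
  weight_symm : ∀ x y, weight x y = weight y x
  weight_nonneg : ∀ x y, 0 ≤ weight x y

namespace WeightedGraph

variable {V : Type*}

/-- `x ∼ y`. -/
def Adj (G : WeightedGraph V) (x y : V) : Prop := 0 < G.weight x y

/-- Any two vertices are joined by a finite path `x₀ ∼ x₁ ∼ ⋯ ∼ xₙ`. -/
def Connected (G : WeightedGraph V) : Prop :=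
  ∀ x y : V, Relation.ReflTransGen G.Adj x y

variable [Fintype V]

/-- The weight `d_x = ∑_y w_{xy}` at the vertex `x`. -/
def vertexWeight (G : WeightedGraph V) (x : V) : ℝ := ∑ y, G.weight x y

variable [MeasurableSpace V]

/-- The random walk `m_x = (1 / d_x) ∑_y w_{xy} δ_y`. -/
def walk (G : WeightedGraph V) (x : V) : Measure V :=
  ∑ y, ENNReal.ofReal (G.weight x y / G.vertexWeight x) • Measure.dirac y

/-- The measure `ν(A) = ∑_{x ∈ A} d_x`. -/
def vol (G : WeightedGraph V) : Measure V :=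
  ∑ x, ENNReal.ofReal (G.vertexWeight x) • Measure.dirac x

instance isFiniteMeasure_vol (G : WeightedGraph V) : IsFiniteMeasure G.vol := by
  refine ⟨?_⟩
  simp [vol, Measure.finsetSum_apply]

/-- The total variation `TV(u) = (1/2) ∫ ∫ |u(y) - u(x)| dm_x(y) dν(x)`. -/
def TV (G : WeightedGraph V) (u : V → ℝ) : ℝ :=
  (1 / 2) * ∫ x, ∫ y, |u y - u x| ∂(G.walk x) ∂G.vol

/-- The `p`-Poincaré inequality. -/
def PoincareInequality (G : WeightedGraph V) (p : ℝ≥0∞) : Prop :=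
  ∃ c : ℝ, 0 < c ∧ ∀ u : V → ℝ, MemLp u 1 G.vol →
    eLpNorm u p G.vol ≤
      ENNReal.ofReal (c * ((∫ x, ∫ y, |u y - u x| ∂(G.walk x) ∂G.vol) + |∫ x, u x ∂G.vol|))

/-- `λ^p = inf { TV(u) / ‖u‖_p : ‖u‖_p ≠ 0, ∫ u dν = 0 }`, an infimum in `[0, ∞]`
(so it is `∞` if there is no such `u`, which happens only for graphs with at most one vertex). -/
def poincareConst (G : WeightedGraph V) (p : ℝ≥0∞) : ℝ≥0∞ :=
  ⨅ (u : V → ℝ) (_ : MemLp u p G.vol) (_ : eLpNorm u p G.vol ≠ 0) (_ : ∫ x, u x ∂G.vol = 0),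
    ENNReal.ofReal (G.TV u) / eLpNorm u p G.vol

/-- The Hilbert space `L²(V, ν)`. -/
abbrev L2 (G : WeightedGraph V) : Type _ := Lp ℝ 2 G.vol

/-- The mean `ν(u) = ν(V)⁻¹ ∫ u dν`, as a constant element of `L²(V, ν)`. -/
def mean (G : WeightedGraph V) (u : G.L2) : G.L2 :=
  Lp.const 2 G.vol (⨍ x, u x ∂G.vol)

end WeightedGraph

/-- The subdifferential of a functional on a real Hilbert space. -/
def subdifferential {H : Type*} [NormedAddCommGroup H] [InnerProductSpace ℝ H]
    (F : H → ℝ) (u : H) : Set H :=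
  {v | ∀ w : H, F u + inner ℝ v (w - u) ≤ F w}

/-- `u ∈ W^{1,1}(0, T; H)` (continuous representative on `[0, T]`) with derivative `g`. -/
def HasW11Deriv {H : Type*} [NormedAddCommGroup H] [NormedSpace ℝ H]
    (T : ℝ) (u g : ℝ → H) : Prop :=
  IntervalIntegrable g volume 0 T ∧ ∀ t ∈ Icc 0 T, u t = u 0 + ∫ s in (0 : ℝ)..t, g s

namespace WeightedGraph

variable {V : Type*} [Fintype V] [MeasurableSpace V]

/-- The multivalued `1`-Laplacian: `v ∈ Δ₁ u` if and only if `-v ∈ ∂TV(u)` in `L²(V, ν)`. -/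
def oneLaplacian (G : WeightedGraph V) (u : G.L2) : Set G.L2 :=
  {v | -v ∈ subdifferential (fun w : G.L2 => G.TV w) u}

/-- `u` solves `u_t - Δ₁ u ∋ 0` in `(0, T)`, `u(0) = u₀`. -/
def IsTVFlowOn (G : WeightedGraph V) (u₀ : G.L2) (T : ℝ) (u : ℝ → G.L2) : Prop :=
  u 0 = u₀ ∧ ∃ u' : ℝ → G.L2, HasW11Deriv T u u' ∧
    ∀ᵐ t ∂(volume.restrict (Ioo 0 T)), u' t ∈ G.oneLaplacian (u t)

end WeightedGraph

end

/-! ### Subgradients of a seminorm -/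

section Subdifferential

variable {H : Type*} [NormedAddCommGroup H] [InnerProductSpace ℝ H]

/-! `L²(V, ν)` is finite-dimensional and `TV` is a seminorm on it. By connectedness, `2 TV(u) + |∫ u
dν|` vanishes only at `u = 0`, so compactness of the unit sphere gives the Poincaré inequality and a
positive `λ²`.

The flow is the gradient flow of this seminorm. Explicit Euler schemes satisfy a discrete evolution
variational inequality; their limit is a Lipschitz curve whose derivative is almost everywhere minus
a subgradient (`Seminorm.exists_gradientFlow`). Uniqueness follows from monotonicity of the
subdifferential.

For decay, `TV` vanishes on constants, so subgradients are orthogonal to them and the mean is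
conserved. By homogeneity `⟨-u', u⟩ = TV(u)`, so `z = u - ν(u₀)` satisfies `⟨u', z⟩ = -TV(z) ≤ -λ²
‖z‖`. While `z ≠ 0` this says `‖z‖' ≤ -λ²`, a linear decay that reaches zero in finite time
(`WeightedGraph.enorm_sub_mean_le`). -/

theorem Seminorm.mem_subdifferential_iff (J : Seminorm ℝ H) {u v : H} :
    v ∈ subdifferential J u ↔ (∀ w, inner ℝ v w ≤ J w) ∧ inner ℝ v u = J u := by
  constructor
  · intro h
    refine ⟨fun w => ?_, le_antisymm ?_ ?_⟩
    · have h1 := h (u + w)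
      have h2 := map_add_le_add J u w
      rw [add_sub_cancel_left] at h1
      linarith
    · have h1 := h (u + u)
      have h2 := map_add_le_add J u u
      rw [add_sub_cancel_left] at h1
      linarith
    · have h1 := h 0
      rw [map_zero, zero_sub, inner_neg_right] at h1
      linarith
  · rintro ⟨h1, h2⟩ w
    have := h1 w
    rw [inner_sub_right, h2]
    linarith

theorem norm_le_of_mem_subdifferential {J : Seminorm ℝ H} {L : ℝ} (hL : ∀ x, J x ≤ L * ‖x‖)
    (hL0 : 0 ≤ L) {u v : H} (hv : v ∈ subdifferential J u) : ‖v‖ ≤ L := by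
  have h1 := (J.mem_subdifferential_iff.1 hv).1 v
  rw [real_inner_self_eq_norm_sq] at h1
  have h2 := hL v
  by_contra! h
  nlinarith [norm_nonneg v]

theorem subdifferential_monotone {F : H → ℝ} {u₁ u₂ v₁ v₂ : H} (h₁ : v₁ ∈ subdifferential F u₁)
    (h₂ : v₂ ∈ subdifferential F u₂) : 0 ≤ inner ℝ (v₁ - v₂) (u₁ - u₂) := by
  have a := h₁ u₂
  have b := h₂ u₁
  rw [← neg_sub u₁ u₂, inner_neg_right] at a
  rw [inner_sub_left]
  linarith

theorem Seminorm.subdifferential_nonempty [CompleteSpace H] (J : Seminorm ℝ H) {L : ℝ}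
    (hL : ∀ x, J x ≤ L * ‖x‖) (u : H) : (subdifferential J u).Nonempty := by
  by_cases hu : u = 0
  · refine ⟨0, J.mem_subdifferential_iff.2 ⟨fun w => ?_, ?_⟩⟩ <;> simp [hu]
  -- Hahn–Banach: `c • u ↦ c * J u` on the line through `u` is dominated by `J`; the Riesz vector of
  -- its extension is a subgradient.
  obtain ⟨g, hg1, hg2⟩ := exists_extension_of_le_sublinear
    (LinearPMap.mkSpanSingleton (K := ℝ) u (J u) hu) J
    (fun c hc x => by rw [map_smul_eq_mul, Real.norm_of_nonneg hc.le])
    (fun x y => map_add_le_add J x y) (by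
      rintro ⟨x, hx⟩
      obtain ⟨c, rfl⟩ := Submodule.mem_span_singleton.1 hx
      rw [LinearPMap.mkSpanSingleton'_apply, map_smul_eq_mul, smul_eq_mul]
      exact mul_le_mul_of_nonneg_right (le_abs_self c) (apply_nonneg J u))
  have hgn : ∀ x, ‖g x‖ ≤ L * ‖x‖ := by
    intro x
    rw [Real.norm_eq_abs, abs_le]
    have h1 := (hg2 (-x)).trans (hL (-x))
    rw [map_neg, norm_neg] at h1
    exact ⟨by linarith, (hg2 x).trans (hL x)⟩
  refine ⟨(InnerProductSpace.toDual ℝ H).symm (g.mkContinuous L hgn),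
    J.mem_subdifferential_iff.2 ⟨fun w => ?_, ?_⟩⟩
  · simpa using hg2 w
  · have := hg1 ⟨u, Submodule.mem_span_singleton_self u⟩
    rw [LinearPMap.mkSpanSingleton_apply] at this
    simpa using this

end Subdifferential

/-! ### Explicit Euler schemes and their limit -/

section Euler

variable {H : Type*} [NormedAddCommGroup H] [InnerProductSpace ℝ H]

theorem dist_le_of_euler {L h : ℝ} (hh : 0 ≤ h) {x p : ℕ → H} (hp : ∀ k, ‖p k‖ ≤ L)
    (hx : ∀ k, x (k + 1) = x k - h • p k) (j n : ℕ) : dist (x j) (x (j + n)) ≤ L * (n * h) := by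
  induction n with
  | zero => simp
  | succ n ih =>
    have h1 : dist (x (j + n)) (x (j + n + 1)) ≤ L * h := by
      rw [hx, dist_eq_norm, sub_sub_cancel, norm_smul, Real.norm_of_nonneg hh, mul_comm]
      exact mul_le_mul_of_nonneg_right (hp _) hh
    calc dist (x j) (x (j + (n + 1))) ≤ _ := dist_triangle _ (x (j + n)) _
      _ ≤ L * (n * h) + L * h := add_le_add ih h1
      _ = L * ((n + 1 : ℕ) * h) := by push_cast; ring

/-- Expand one step and apply the subgradient inequality at `x (j + n)`. Replacing `J (x (j + n))`
by `J (x j)` costs `L² n h`, so the step error is `L² h² (2 n + 1)`, which telescopes to `L² (n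
h)²`. -/
theorem norm_sub_sq_le_of_euler {J : Seminorm ℝ H} {L h : ℝ} (hL : ∀ x, J x ≤ L * ‖x‖)
    (hL0 : 0 ≤ L) (hh : 0 ≤ h) {x p : ℕ → H} (hp : ∀ k, p k ∈ subdifferential J (x k))
    (hx : ∀ k, x (k + 1) = x k - h • p k) (w : H) (j n : ℕ) :
    ‖x (j + n) - w‖ ^ 2 ≤
      ‖x j - w‖ ^ 2 + 2 * (n * h) * (J w - J (x j)) + L ^ 2 * (n * h) ^ 2 := by
  have hpn : ∀ k, ‖p k‖ ≤ L := fun k => norm_le_of_mem_subdifferential hL hL0 (hp k)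
  induction n with
  | zero => simp
  | succ n ih =>
    have h1 : ‖x (j + n + 1) - w‖ ^ 2 =
        ‖x (j + n) - w‖ ^ 2 + 2 * h * inner ℝ (p (j + n)) (w - x (j + n))
          + h ^ 2 * ‖p (j + n)‖ ^ 2 := by
      rw [hx, sub_right_comm, norm_sub_sq_real, norm_smul, inner_smul_right, mul_pow,
        Real.norm_eq_abs, sq_abs, ← neg_sub (x (j + n)) w, inner_neg_right, real_inner_comm]
      ring
    have h2 := hp (j + n) w
    have h3 : J (x j) - J (x (j + n)) ≤ L * (L * (n * h)) :=
      ((le_abs_self _).trans (abs_sub_map_le_sub J _ _)).trans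
        ((hL _).trans (mul_le_mul_of_nonneg_left
          (by simpa [dist_eq_norm] using dist_le_of_euler hh hpn hx j n) hL0))
    have h4 : ‖p (j + n)‖ ^ 2 ≤ L ^ 2 := pow_le_pow_left₀ (norm_nonneg _) (hpn _) 2
    rw [← add_assoc, h1]
    have h5 : 2 * h * inner ℝ (p (j + n)) (w - x (j + n)) ≤
        2 * h * (J w - J (x j) + L * (L * (n * h))) :=
      mul_le_mul_of_nonneg_left (by linarith) (by positivity)
    have h6 := mul_le_mul_of_nonneg_left h4 (sq_nonneg h)
    push_cast
    linarith

/-- A Lipschitz curve satisfying the integrated evolution variational inequality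
of a seminorm, obtained as a limit of explicit Euler schemes. -/
theorem Seminorm.exists_evolution_curve [FiniteDimensional ℝ H] (J : Seminorm ℝ H) {L : NNReal}
    (hL : ∀ x, J x ≤ L * ‖x‖) (hJ : Continuous J) (u₀ : H) :
    ∃ u : ℝ → H, LipschitzWith L u ∧ u 0 = u₀ ∧ ∀ w s t, 0 ≤ s → s ≤ t →
      ‖u t - w‖ ^ 2 ≤
        ‖u s - w‖ ^ 2 + 2 * (t - s) * (J w - J (u s)) + (L : ℝ) ^ 2 * (t - s) ^ 2 := by
  have : CompleteSpace H := FiniteDimensional.complete ℝ H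
  have : ProperSpace H := FiniteDimensional.proper ℝ H
  choose P hP using fun x => J.subdifferential_nonempty hL x
  let h : ℕ → ℝ := fun n => 1 / ((n : ℝ) + 1)
  have hh : ∀ n, 0 ≤ h n := fun n => by positivity
  let x : ℕ → ℕ → H := fun n k => (fun y => y - h n • P y)^[k] u₀
  have hx : ∀ n k, x n (k + 1) = x n k - h n • P (x n k) :=
    fun n k => Function.iterate_succ_apply' _ _ _
  let κ : ℕ → ℝ → ℕ := fun n t => ⌊t * ((n : ℝ) + 1)⌋₊
  have hκmono : ∀ n s t, s ≤ t → κ n s ≤ κ n t := fun n s t hst =>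
    Nat.floor_mono (mul_le_mul_of_nonneg_right hst (by positivity))
  have hκ : ∀ n s t, s ≤ t → ((κ n t - κ n s : ℕ) : ℝ) * h n ≤ (t - s) + h n := by
    intro n s t hst
    have hn : (0 : ℝ) < (n : ℝ) + 1 := by positivity
    rw [Nat.cast_sub (hκmono n s t hst)]
    have h1 : s * ((n : ℝ) + 1) < κ n s + 1 := Nat.lt_floor_add_one _
    have h2 : (κ n t : ℝ) ≤ (κ n s : ℝ) + 1 + (t - s) * ((n : ℝ) + 1) := by
      by_cases ht : 0 ≤ t
      · have : (κ n t : ℝ) ≤ t * ((n : ℝ) + 1) := Nat.floor_le (by positivity)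
        linarith
      · have : κ n t = 0 := Nat.floor_of_nonpos (mul_nonpos_of_nonpos_of_nonneg (by linarith) hn.le)
        rw [this]
        have := mul_nonneg (sub_nonneg.2 hst) hn.le
        push_cast
        positivity
    simp only [h]
    rw [mul_one_div, div_le_iff₀ hn, add_mul, one_div, inv_mul_cancel₀ hn.ne']
    linarith
  let X : ℕ → ℝ → H := fun n t => x n (κ n t)
  have hXd : ∀ n s t, s ≤ t → dist (X n s) (X n t) ≤ L * ((t - s) + h n) := by
    intro n s t hst
    have h1 := dist_le_of_euler (L := L) (hh n) (fun k => norm_le_of_mem_subdifferential hL L.2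
      (hP (x n k))) (hx n) (κ n s) (κ n t - κ n s)
    rw [Nat.add_sub_cancel' (hκmono n s t hst)] at h1
    exact h1.trans (mul_le_mul_of_nonneg_left (hκ n s t hst) L.2)
  have hX0 : ∀ n, X n 0 = u₀ := fun n => by simp [X, x, κ]
  have hh1 : ∀ n, h n ≤ 1 := fun n => by
    simp only [h]
    rw [div_le_one (by positivity)]
    linarith [(Nat.cast_nonneg n : (0 : ℝ) ≤ n)]
  have hXb : ∀ n t, X n t ∈ Metric.closedBall u₀ (L * (|t| + 1)) := by
    intro n t
    rw [Metric.mem_closedBall, ← hX0 n]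
    rcases le_total 0 t with ht | ht
    · rw [dist_comm, abs_of_nonneg ht]
      refine (hXd n 0 t ht).trans (mul_le_mul_of_nonneg_left ?_ L.2)
      linarith [hh1 n]
    · rw [abs_of_nonpos ht]
      refine (hXd n t 0 ht).trans (mul_le_mul_of_nonneg_left ?_ L.2)
      linarith [hh1 n]
  -- A nonprincipal ultrafilter gives limits at all times at once, so no subsequence has to be
  -- extracted.
  let U : Filter ℕ := Filter.hyperfilter ℕ
  have hU : U ≤ Filter.atTop := Nat.hyperfilter_le_atTop
  have hlim : ∀ t, ∃ y, Filter.Tendsto (fun n => X n t) U (nhds y) := by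
    intro t
    obtain ⟨y, -, hy⟩ := (isCompact_closedBall u₀ (L * (|t| + 1))).ultrafilter_le_nhds
      ((Filter.hyperfilter ℕ).map (fun n => X n t))
      (Filter.le_principal_iff.2 (Filter.mem_map.2 (Filter.univ_mem' fun n => hXb n t)))
    exact ⟨y, hy⟩
  choose u hu using hlim
  have hht : Filter.Tendsto h U (nhds 0) := tendsto_one_div_add_atTop_nhds_zero_nat.mono_left hU
  have hκt : ∀ t, 0 ≤ t → Filter.Tendsto (fun n => (κ n t : ℝ) * h n) U (nhds t) := by
    intro t ht
    have := ((tendsto_nat_floor_mul_div_atTop ht).comp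
      (Filter.tendsto_atTop_add_const_right _ (1 : ℝ) tendsto_natCast_atTop_atTop)).mono_left hU
    refine this.congr fun n => ?_
    simp [κ, h, div_eq_mul_inv]
  refine ⟨u, ?_, ?_, ?_⟩
  · have key : ∀ s t, s ≤ t → dist (u s) (u t) ≤ L * (t - s) := by
      intro s t hst
      have h1 : Filter.Tendsto (fun n => (L : ℝ) * ((t - s) + h n)) U (nhds (L * ((t - s) + 0))) :=
        (tendsto_const_nhds.add hht).const_mul _
      rw [add_zero] at h1
      exact le_of_tendsto_of_tendsto' ((hu s).dist (hu t)) h1 (fun n => hXd n s t hst)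
    refine LipschitzWith.of_dist_le_mul fun s t => ?_
    rcases le_total s t with hst | hst
    · rw [dist_comm s t, Real.dist_eq, abs_of_nonneg (sub_nonneg.2 hst)]
      exact key s t hst
    · rw [dist_comm (u s), Real.dist_eq, abs_of_nonneg (sub_nonneg.2 hst)]
      exact key t s hst
  · exact tendsto_nhds_unique (hu 0) (by simp [hX0])
  · intro w s t hs hst
    have hτ : Filter.Tendsto (fun n => ((κ n t - κ n s : ℕ) : ℝ) * h n) U (nhds (t - s)) := by
      refine ((hκt t (hs.trans hst)).sub (hκt s hs)).congr fun n => ?_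
      rw [Nat.cast_sub (hκmono n s t hst), sub_mul]
    have hJs : Filter.Tendsto (fun n => J (X n s)) U (nhds (J (u s))) :=
      (hJ.tendsto _).comp (hu s)
    refine le_of_tendsto_of_tendsto' ((((hu t).sub_const w).norm).pow 2)
      ((((((hu s).sub_const w).norm).pow 2).add
        ((hτ.const_mul 2).mul (tendsto_const_nhds.sub hJs))).add ((hτ.pow 2).const_mul _))
      fun n => ?_
    have := norm_sub_sq_le_of_euler hL L.2 (hh n) (fun k => hP (x n k)) (hx n) w (κ n s)
      (κ n t - κ n s)
    rwa [Nat.add_sub_cancel' (hκmono n s t hst)] at this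

end Euler

/-! ### Absolute continuity and `W^{1,1}` curves -/

section AbsolutelyContinuous

variable {X Y : Type*} [PseudoMetricSpace X] [PseudoMetricSpace Y]

theorem AbsolutelyContinuousOnInterval.of_dist_le {f : ℝ → X} {g : ℝ → Y} {a b : ℝ}
    (hg : AbsolutelyContinuousOnInterval g a b)
    (hfg : ∀ x ∈ uIcc a b, ∀ y ∈ uIcc a b, dist (f x) (f y) ≤ dist (g x) (g y)) :
    AbsolutelyContinuousOnInterval f a b := by
  rw [absolutelyContinuousOnInterval_iff] at hg ⊢
  intro ε hε
  obtain ⟨δ, hδ, h⟩ := hg ε hε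
  refine ⟨δ, hδ, fun E hE hlt => (Finset.sum_le_sum fun i hi => ?_).trans_lt (h E hE hlt)⟩
  exact hfg _ (hE.1 i hi).1 _ (hE.1 i hi).2

end AbsolutelyContinuous

section W11

variable {H : Type*} [NormedAddCommGroup H] [NormedSpace ℝ H] {T : ℝ} {u g v k : ℝ → H}

theorem IntervalIntegrable.absolutelyContinuousOnInterval_primitive
    (hg : IntervalIntegrable g volume 0 T) :
    AbsolutelyContinuousOnInterval (fun t => ∫ s in (0 : ℝ)..t, g s) 0 T := by
  have hsub : ∀ x ∈ uIcc 0 T, IntervalIntegrable g volume 0 x := fun x hx =>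
    hg.mono_set (uIcc_subset_uIcc left_mem_uIcc hx)
  have key : ∀ x ∈ uIcc 0 T, ∀ y ∈ uIcc 0 T, x ≤ y →
      dist (∫ s in (0 : ℝ)..x, g s) (∫ s in (0 : ℝ)..y, g s) ≤
        dist (∫ s in (0 : ℝ)..x, ‖g s‖) (∫ s in (0 : ℝ)..y, ‖g s‖) := by
    intro x hx y hy hxy
    rw [dist_comm, dist_comm (∫ s in (0 : ℝ)..x, ‖g s‖), dist_eq_norm, Real.dist_eq,
      intervalIntegral.integral_interval_sub_left (hsub y hy) (hsub x hx),
      intervalIntegral.integral_interval_sub_left (hsub y hy).norm (hsub x hx).norm]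
    exact (intervalIntegral.norm_integral_le_integral_norm hxy).trans (le_abs_self _)
  refine (hg.norm.absolutelyContinuousOnInterval_intervalIntegral
    (left_mem_uIcc (a := (0 : ℝ)) (b := T))).of_dist_le fun x hx y hy => ?_
  rcases le_total x y with hxy | hxy
  · exact key x hx y hy hxy
  · rw [dist_comm, dist_comm (∫ s in (0 : ℝ)..x, ‖g s‖)]
    exact key y hy x hx hxy

theorem HasW11Deriv.absolutelyContinuousOnInterval (h : HasW11Deriv T u g) (hT : 0 ≤ T) :
    AbsolutelyContinuousOnInterval u 0 T := by
  refine h.1.absolutelyContinuousOnInterval_primitive.of_dist_le fun x hx y hy => ?_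
  rw [uIcc_of_le hT] at hx hy
  rw [h.2 x hx, h.2 y hy, dist_add_left]

theorem HasW11Deriv.ae_hasDerivAt [CompleteSpace H] (h : HasW11Deriv T u g) :
    ∀ᵐ t ∂(volume.restrict (Ioo 0 T)), HasDerivAt u (g t) t := by
  rw [ae_restrict_iff' measurableSet_Ioo]
  filter_upwards [h.1.ae_hasDerivAt_integral] with t ht hIoo
  have hT : (0 : ℝ) ≤ T := (hIoo.1.trans hIoo.2).le
  have h1 := (ht (by rw [uIcc_of_le hT]; exact Ioo_subset_Icc_self hIoo) 0
    left_mem_uIcc).const_add (u 0)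
  refine h1.congr_of_eventuallyEq ?_
  filter_upwards [isOpen_Ioo.mem_nhds hIoo] with s hs
  exact h.2 s (Ioo_subset_Icc_self hs)

theorem HasW11Deriv.mono {S : ℝ} (h : HasW11Deriv T u g) (hS : 0 ≤ S) (hST : S ≤ T) :
    HasW11Deriv S u g :=
  ⟨h.1.mono_set (uIcc_subset_uIcc left_mem_uIcc
      (by rw [uIcc_of_le (hS.trans hST)]; exact ⟨hS, hST⟩)),
    fun t ht => h.2 t ⟨ht.1, ht.2.trans hST⟩⟩

theorem HasW11Deriv.sub (hu : HasW11Deriv T u g) (hv : HasW11Deriv T v k) :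
    HasW11Deriv T (fun t => u t - v t) (fun t => g t - k t) := by
  refine ⟨hu.1.sub hv.1, fun t ht => ?_⟩
  have hsub : uIcc 0 t ⊆ uIcc 0 T := uIcc_subset_uIcc left_mem_uIcc
    (by rw [uIcc_of_le (ht.1.trans ht.2)]; exact ht)
  rw [intervalIntegral.integral_sub (hu.1.mono_set hsub) (hv.1.mono_set hsub)]
  simp only [hu.2 t ht, hv.2 t ht]
  abel

theorem HasW11Deriv.sub_const (hu : HasW11Deriv T u g) (c : H) :
    HasW11Deriv T (fun t => u t - c) g :=
  ⟨hu.1, fun t ht => by simp only [hu.2 t ht]; abel⟩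

theorem LipschitzWith.hasW11Deriv [FiniteDimensional ℝ H] {L : NNReal} (hu : LipschitzWith L u)
    (hT : 0 ≤ T) : HasW11Deriv T u (deriv u) := by
  have : CompleteSpace H := FiniteDimensional.complete ℝ H
  have hint : IntervalIntegrable (deriv u) volume 0 T :=
    (intervalIntegrable_const (c := (L : ℝ))).mono_fun
      (aestronglyMeasurable_deriv _ _) (Filter.Eventually.of_forall fun t => by
        refine le_of_le_of_eq ?_ (Real.norm_of_nonneg L.2).symm
        exact norm_deriv_le_of_lipschitz hu)
  refine ⟨hint, fun t ht => ?_⟩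
  -- `u` minus the primitive of its derivative is absolutely continuous with zero derivative almost
  -- everywhere, hence constant.
  have hac := (hu.lipschitzOnWith (s := uIcc 0 T)).absolutelyContinuousOnInterval.sub
    hint.absolutelyContinuousOnInterval_primitive
  obtain ⟨C, hC⟩ := hac.const_of_ae_hasDerivAt_zero (by
    filter_upwards [hint.ae_hasDerivAt_integral, hu.ae_differentiableAt_real] with x hx hux hmem
    simpa using hux.hasDerivAt.sub (hx hmem 0 left_mem_uIcc))
  have h0 := hC 0 left_mem_uIcc
  have h1 := hC t (by rwa [uIcc_of_le hT])
  simp only [Pi.sub_apply, intervalIntegral.integral_same, sub_zero] at h0 h1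
  rw [h0, ← h1]
  abel

end W11

/-! ### Differential inequalities for the norm -/

section Decay

variable {H : Type*} [NormedAddCommGroup H] [InnerProductSpace ℝ H]
  {T : ℝ} {z g : ℝ → H}

theorem HasW11Deriv.norm_absolutelyContinuousOnInterval (h : HasW11Deriv T z g) (hT : 0 ≤ T) :
    AbsolutelyContinuousOnInterval (fun t => ‖z t‖) 0 T :=
  (h.absolutelyContinuousOnInterval hT).of_dist_le fun x _ y _ => by
    rw [Real.dist_eq, dist_eq_norm]
    exact abs_norm_sub_norm_le _ _

theorem AbsolutelyContinuousOnInterval.sub_le_of_deriv_le {f : ℝ → ℝ} {a b c : ℝ} (hab : a ≤ b)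
    (hf : AbsolutelyContinuousOnInterval f a b)
    (hd : ∀ᵐ t ∂(volume.restrict (Ioo a b)), deriv f t ≤ c) : f b - f a ≤ c * (b - a) := by
  rw [← hf.integral_deriv_eq_sub]
  calc ∫ t in a..b, deriv f t ≤ ∫ _ in a..b, c := by
        refine intervalIntegral.integral_mono_ae_restrict hab hf.intervalIntegrable_deriv
          intervalIntegrable_const ?_
        rwa [Filter.EventuallyLE, ← restrict_Ioo_eq_restrict_Icc]
    _ = c * (b - a) := by simp [mul_comm]

variable [CompleteSpace H]

theorem HasW11Deriv.inner_eq_of_inner_eq_zero (h : HasW11Deriv T z g) {w : H}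
    (hg : ∀ᵐ t ∂(volume.restrict (Ioo 0 T)), inner ℝ w (g t) = 0) {t : ℝ} (ht : t ∈ Icc 0 T) :
    inner ℝ w (z t) = inner ℝ w (z 0) := by
  have hgt := (h.mono ht.1 ht.2).1
  have h1 := (innerSL ℝ w).intervalIntegral_comp_comm hgt
  simp only [innerSL_apply_apply] at h1
  rw [h.2 t ht, inner_add_right, ← h1, intervalIntegral.integral_of_le ht.1,
    ← restrict_Ioo_eq_restrict_Ioc, integral_eq_zero_of_ae, add_zero]
  exact ae_restrict_of_ae_restrict_of_subset (Ioo_subset_Ioo_right ht.2) hg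

theorem HasW11Deriv.norm_le_of_inner_nonpos (h : HasW11Deriv T z g)
    (hg : ∀ᵐ t ∂(volume.restrict (Ioo 0 T)), inner ℝ (g t) (z t) ≤ 0) {s t : ℝ} (hs : 0 ≤ s)
    (hst : s ≤ t) (htT : t ≤ T) : ‖z t‖ ≤ ‖z s‖ := by
  have hT : 0 ≤ T := hs.trans (hst.trans htT)
  have hN := h.norm_absolutelyContinuousOnInterval hT
  have hac : AbsolutelyContinuousOnInterval (fun t => ‖z t‖ ^ 2) s t := by
    simp only [pow_two]
    refine (hN.fun_mul hN).mono ?_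
    rw [uIcc_of_le hst, uIcc_of_le hT]
    exact Icc_subset_Icc hs htT
  have := hac.sub_le_of_deriv_le hst (c := 0) (by
    have hsub : Ioo s t ⊆ Ioo 0 T := Ioo_subset_Ioo hs htT
    filter_upwards [ae_restrict_of_ae_restrict_of_subset hsub hg,
      ae_restrict_of_ae_restrict_of_subset hsub h.ae_hasDerivAt] with r h1 h2
    rw [h2.norm_sq.deriv, real_inner_comm]
    linarith)
  refine le_of_sq_le_sq ?_ (norm_nonneg _)
  linarith

theorem HasW11Deriv.norm_le_max_of_inner_le (h : HasW11Deriv T z g) (hT : 0 ≤ T) {l : ℝ}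
    (hl : 0 ≤ l)
    (hg : ∀ᵐ t ∂(volume.restrict (Ioo 0 T)), inner ℝ (g t) (z t) ≤ -l * ‖z t‖) :
    ‖z T‖ ≤ max (‖z 0‖ - l * T) 0 := by
  -- If `z T ≠ 0`, monotonicity of the norm keeps `z` away from `0` on `[0, T]`, where the norm can
  -- be differentiated.
  by_cases hz : z T = 0
  · simp [hz]
  have hanti : ∀ t ∈ Icc 0 T, ‖z T‖ ≤ ‖z t‖ := fun t ht =>
    h.norm_le_of_inner_nonpos (by
      filter_upwards [hg] with r hr
      exact hr.trans (by nlinarith [norm_nonneg (z r)])) ht.1 ht.2 le_rfl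
  have := (h.norm_absolutelyContinuousOnInterval hT).sub_le_of_deriv_le hT (c := -l) (by
    filter_upwards [hg, h.ae_hasDerivAt, ae_restrict_mem measurableSet_Ioo] with t h1 h2 h3
    have hpos : 0 < ‖z t‖ :=
      (norm_pos_iff.2 hz).trans_le (hanti t (Ioo_subset_Icc_self h3))
    have h4 := h2.norm_sq.sqrt (by positivity)
    simp only [Real.sqrt_sq (norm_nonneg _)] at h4
    rw [h4.deriv, mul_div_mul_left _ _ two_ne_zero, div_le_iff₀ hpos, real_inner_comm]
    exact h1)
  exact le_max_of_le_left (by linarith)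

end Decay

/-! ### Gradient flow of a seminorm: existence and uniqueness -/

section GradientFlow

variable {H : Type*} [NormedAddCommGroup H] [InnerProductSpace ℝ H]

/-- Divide by `t - s` and let `t ↓ s`: the quadratic error disappears and `2 ⟨u s - w, u'⟩ ≤ 2 (F w
- F (u s))` remains. -/
theorem HasDerivAt.neg_mem_subdifferential {F : H → ℝ} {C : ℝ} {u : ℝ → H} {u' : H} {s : ℝ}
    (hu : HasDerivAt u u' s)
    (h : ∀ w t, s ≤ t →
      ‖u t - w‖ ^ 2 ≤ ‖u s - w‖ ^ 2 + 2 * (t - s) * (F w - F (u s)) + C * (t - s) ^ 2) :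
    -u' ∈ subdifferential F (u s) := by
  intro w
  have h1 := (hasDerivWithinAt_iff_tendsto_slope' self_notMem_Ioi).1
    ((hu.sub_const w).norm_sq.hasDerivWithinAt (s := Ioi s))
  have h2 : Filter.Tendsto (fun t => 2 * (F w - F (u s)) + C * (t - s)) (nhdsWithin s (Ioi s))
      (nhds (2 * (F w - F (u s)) + C * (s - s))) :=
    Filter.Tendsto.mono_left (Continuous.tendsto (by fun_prop) s) nhdsWithin_le_nhds
  have h3 := le_of_tendsto_of_tendsto h1 h2 (by
    filter_upwards [self_mem_nhdsWithin] with t ht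
    have hpos : 0 < t - s := sub_pos.2 ht
    rw [slope_def_field, div_le_iff₀ hpos]
    linarith [h w t (le_of_lt ht)])
  rw [← neg_sub (u s) w, inner_neg_neg, real_inner_comm]
  linarith

/-- Existence of the gradient flow of a seminorm. -/
theorem Seminorm.exists_gradientFlow [FiniteDimensional ℝ H] (J : Seminorm ℝ H) (u₀ : H) :
    ∃ u u' : ℝ → H, u 0 = u₀ ∧ ∀ T, 0 < T → HasW11Deriv T u u' ∧
      ∀ᵐ t ∂(volume.restrict (Ioo 0 T)), -u' t ∈ subdifferential J (u t) := by
  have hJ : Continuous J := J.convexOn.locallyLipschitz.continuous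
  obtain ⟨C, hC0, hC⟩ := J.bound_of_continuous_normedSpace hJ
  obtain ⟨u, hu, hu0, hevi⟩ := J.exists_evolution_curve (L := ⟨C, hC0.le⟩) hC hJ u₀
  refine ⟨u, deriv u, hu0, fun T hT => ⟨hu.hasW11Deriv hT.le, ?_⟩⟩
  filter_upwards [ae_restrict_of_ae hu.ae_differentiableAt_real,
    ae_restrict_mem measurableSet_Ioo] with s hs hmem
  exact hs.hasDerivAt.neg_mem_subdifferential fun w t hst => hevi w s t hmem.1.le hst

theorem HasW11Deriv.eqOn_of_neg_mem_subdifferential [CompleteSpace H] {F : H → ℝ} {T : ℝ}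
    {u g v k : ℝ → H} (hu : HasW11Deriv T u g) (hv : HasW11Deriv T v k)
    (hg : ∀ᵐ t ∂(volume.restrict (Ioo 0 T)), -g t ∈ subdifferential F (u t))
    (hk : ∀ᵐ t ∂(volume.restrict (Ioo 0 T)), -k t ∈ subdifferential F (v t)) (h0 : u 0 = v 0) :
    EqOn u v (Icc 0 T) := by
  intro t ht
  have := (hu.sub hv).norm_le_of_inner_nonpos (by
    filter_upwards [hg, hk] with r h1 h2
    have := subdifferential_monotone h1 h2
    rw [← neg_sub', inner_neg_left] at this
    linarith) le_rfl ht.1 ht.2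
  rwa [h0, sub_self, norm_zero, norm_le_zero_iff, sub_eq_zero] at this

end GradientFlow

/-- The constant is the inverse of the minimum of `N` on the compact unit sphere. -/
theorem Seminorm.exists_norm_le_mul {H : Type*} [NormedAddCommGroup H] [NormedSpace ℝ H]
    [FiniteDimensional ℝ H] (N : Seminorm ℝ H) (hN : ∀ x, N x = 0 → x = 0) :
    ∃ c, 0 < c ∧ ∀ x, ‖x‖ ≤ c * N x := by
  have : ProperSpace H := FiniteDimensional.proper ℝ H
  have hcont : Continuous N := N.convexOn.locallyLipschitz.continuous
  rcases subsingleton_or_nontrivial H with hs | hs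
  · exact ⟨1, one_pos, fun x => by simp [Subsingleton.elim x 0]⟩
  obtain ⟨x₀, hx₀, hmin⟩ := (isCompact_sphere (0 : H) 1).exists_isMinOn
    (NormedSpace.sphere_nonempty.2 zero_le_one) hcont.continuousOn
  have hpos : 0 < N x₀ := (apply_nonneg N x₀).lt_of_ne fun h => by
    have := hN x₀ h.symm
    simp [this] at hx₀
  refine ⟨(N x₀)⁻¹, inv_pos.2 hpos, fun x => ?_⟩
  by_cases hx : x = 0
  · simp [hx]
  have hx' : 0 < ‖x‖ := norm_pos_iff.2 hx
  have h1 : N x₀ ≤ N (‖x‖⁻¹ • x) := hmin (by simp [norm_smul, hx'.ne'])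
  rw [map_smul_eq_mul, norm_inv, norm_norm, inv_mul_eq_div, le_div_iff₀ hx'] at h1
  rw [inv_mul_eq_div, le_div_iff₀ hpos]
  linarith

/-! ### Total variation on the graph, Poincaré inequality, decay -/

namespace WeightedGraph

variable {V : Type*} [Fintype V] (G : WeightedGraph V)

theorem vertexWeight_nonneg (x : V) : 0 ≤ G.vertexWeight x :=
  Finset.sum_nonneg fun y _ => G.weight_nonneg x y

theorem weight_le_vertexWeight (x y : V) : G.weight x y ≤ G.vertexWeight x :=
  Finset.single_le_sum (f := fun y => G.weight x y) (fun y _ => G.weight_nonneg x y)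
    (Finset.mem_univ y)

variable [MeasurableSpace V]

theorem integral_integral_abs_sub_eq_two_mul_TV (u : V → ℝ) :
    ∫ x, ∫ y, |u y - u x| ∂(G.walk x) ∂G.vol = 2 * G.TV u := by
  rw [TV]; ring

variable [DiscreteMeasurableSpace V]

theorem ae_vol_iff {p : V → Prop} :
    (∀ᵐ x ∂G.vol, p x) ↔ ∀ x, 0 < G.vertexWeight x → p x := by
  rw [vol, ae_finsetSum_measure_iff]
  refine forall_congr' fun x => ?_
  by_cases hx : 0 < G.vertexWeight x
  · simp [hx]
  · simp [hx, ENNReal.ofReal_of_nonpos (not_lt.1 hx)]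

theorem integral_sum_smul_dirac (a : V → ℝ) (ha : ∀ x, 0 ≤ a x) (u : V → ℝ) :
    ∫ x, u x ∂(∑ x, ENNReal.ofReal (a x) • Measure.dirac x) = ∑ x, a x * u x := by
  rw [integral_finsetSum_measure]
  · refine Finset.sum_congr rfl fun x _ => ?_
    rw [integral_smul_measure, integral_dirac, ENNReal.toReal_ofReal (ha x), smul_eq_mul]
  · intro x _
    exact (integrable_dirac (by simp)).smul_measure ENNReal.ofReal_ne_top

theorem integral_vol (u : V → ℝ) : ∫ x, u x ∂G.vol = ∑ x, G.vertexWeight x * u x :=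
  integral_sum_smul_dirac _ G.vertexWeight_nonneg u

theorem integral_integral_abs_sub (u : V → ℝ) :
    ∫ x, ∫ y, |u y - u x| ∂(G.walk x) ∂G.vol = ∑ x, ∑ y, G.weight x y * |u y - u x| := by
  rw [integral_vol]
  refine Finset.sum_congr rfl fun x _ => ?_
  rw [walk, integral_sum_smul_dirac _
    fun y => div_nonneg (G.weight_nonneg x y) (G.vertexWeight_nonneg x), Finset.mul_sum]
  refine Finset.sum_congr rfl fun y _ => ?_
  by_cases hx : G.vertexWeight x = 0
  · have : G.weight x y = 0 :=
      le_antisymm (hx ▸ G.weight_le_vertexWeight x y) (G.weight_nonneg x y)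
    simp [this]
  · rw [← mul_assoc, mul_div_cancel₀ _ hx]

theorem TV_eq_sum (u : V → ℝ) :
    G.TV u = 1 / 2 * ∑ x, ∑ y, G.weight x y * |u y - u x| := by
  rw [TV, integral_integral_abs_sub]

/-- Both ends of an edge have positive vertex weight, so `ν`-null vertices do not contribute. This
makes `TV` well defined on `L²` classes. -/
theorem TV_congr_ae {u v : V → ℝ} (h : u =ᵐ[G.vol] v) : G.TV u = G.TV v := by
  rw [Filter.EventuallyEq, ae_vol_iff] at h
  rw [TV_eq_sum, TV_eq_sum]
  congr 1
  refine Finset.sum_congr rfl fun x _ => Finset.sum_congr rfl fun y _ => ?_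
  rcases (G.weight_nonneg x y).eq_or_lt with hw | hw
  · simp [← hw]
  · rw [h x (hw.trans_le (G.weight_le_vertexWeight x y)),
      h y ((G.weight_symm x y ▸ hw).trans_le (G.weight_le_vertexWeight y x))]

theorem TV_add_le (u v : V → ℝ) : G.TV (u + v) ≤ G.TV u + G.TV v := by
  simp only [TV_eq_sum]
  rw [← mul_add, ← Finset.sum_add_distrib]
  refine mul_le_mul_of_nonneg_left (Finset.sum_le_sum fun x _ => ?_) (by norm_num)
  rw [← Finset.sum_add_distrib]
  refine Finset.sum_le_sum fun y _ => ?_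
  rw [← mul_add]
  refine mul_le_mul_of_nonneg_left ?_ (G.weight_nonneg x y)
  rw [Pi.add_apply, Pi.add_apply, add_sub_add_comm]
  exact abs_add_le _ _

theorem TV_smul (c : ℝ) (u : V → ℝ) : G.TV (c • u) = ‖c‖ * G.TV u := by
  simp only [TV_eq_sum, Pi.smul_apply, smul_eq_mul, ← mul_sub, abs_mul, Real.norm_eq_abs,
    Finset.mul_sum]
  refine Finset.sum_congr rfl fun x _ => Finset.sum_congr rfl fun y _ => ?_
  ring

theorem TV_const (c : ℝ) : G.TV (fun _ => c) = 0 := by simp [TV_eq_sum]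

theorem TV_nonneg (u : V → ℝ) : 0 ≤ G.TV u := by
  rw [TV_eq_sum]
  exact mul_nonneg (by norm_num) (Finset.sum_nonneg fun x _ => Finset.sum_nonneg fun y _ =>
    mul_nonneg (G.weight_nonneg x y) (abs_nonneg _))

/-- The total variation as a seminorm on `L²(V, ν)`. -/
noncomputable def tvSeminorm : Seminorm ℝ G.L2 :=
  Seminorm.of (fun u => G.TV u)
    (fun u v => (G.TV_congr_ae (Lp.coeFn_add u v)).trans_le (G.TV_add_le u v))
    (fun c u => (G.TV_congr_ae (Lp.coeFn_smul c u)).trans (G.TV_smul c u))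

/-- The integral with respect to `ν` as a linear form on `L²(V, ν)`. -/
noncomputable def integralForm : G.L2 →ₗ[ℝ] ℝ where
  toFun u := ∫ x, u x ∂G.vol
  map_add' u v := by
    rw [integral_congr_ae (Lp.coeFn_add u v)]
    exact integral_add .of_finite .of_finite
  map_smul' c u := by
    rw [integral_congr_ae (Lp.coeFn_smul c u)]
    exact integral_const_mul c _

theorem integralForm_apply (u : G.L2) : G.integralForm u = ∫ x, u x ∂G.vol := rfl

instance finiteDimensional_L2 : FiniteDimensional ℝ G.L2 := by
  let f : (V → ℝ) →ₗ[ℝ] G.L2 :=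
    { toFun := fun u => (MemLp.of_discrete (f := u)).toLp u
      map_add' := fun u v => MemLp.toLp_add _ _
      map_smul' := fun c u => MemLp.toLp_const_smul c _ }
  exact Module.Finite.of_surjective f fun u => ⟨u, Lp.toLp_coeFn u (Lp.memLp u)⟩

theorem tvSeminorm_const (c : ℝ) : G.tvSeminorm (Lp.const 2 G.vol c) = 0 :=
  (G.TV_congr_ae (Lp.coeFn_const 2 G.vol c)).trans (G.TV_const c)

theorem inner_const_one (u : G.L2) : inner ℝ (Lp.const 2 G.vol (1 : ℝ)) u = G.integralForm u := by
  rw [L2.inner_def, integralForm_apply]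
  refine integral_congr_ae ?_
  filter_upwards [Lp.coeFn_const 2 G.vol (1 : ℝ)] with x hx
  rw [hx]
  simp

theorem integralForm_mean (u : G.L2) : G.integralForm (G.mean u) = G.integralForm u := by
  rw [integralForm_apply, integralForm_apply, mean, integral_congr_ae (Lp.coeFn_const _ _ _)]
  simp only [Function.const_apply, integral_const]
  exact measure_smul_average _ _

variable {G}

theorem eq_of_TV_eq_zero (hG : G.Connected) {u : V → ℝ} (hu : G.TV u = 0) (x y : V) :
    u x = u y := by
  have hadj : ∀ x y, G.Adj x y → u x = u y := by
    intro x y hxy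
    have h1 : ∀ x y, 0 ≤ G.weight x y * |u y - u x| := fun x y =>
      mul_nonneg (G.weight_nonneg x y) (abs_nonneg _)
    rw [TV_eq_sum, mul_eq_zero, or_iff_right (by norm_num),
      Finset.sum_eq_zero_iff_of_nonneg fun x _ => Finset.sum_nonneg fun y _ => h1 x y] at hu
    have h2 := (Finset.sum_eq_zero_iff_of_nonneg fun y _ => h1 x y).1 (hu x (Finset.mem_univ x)) y
      (Finset.mem_univ y)
    rw [mul_eq_zero, or_iff_right (ne_of_gt hxy), abs_eq_zero, sub_eq_zero] at h2
    exact h2.symm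
  induction hG x y with
  | refl => rfl
  | tail _ hbc ih => exact ih.trans (hadj _ _ hbc)

theorem eq_zero_of_tvSeminorm_eq_zero (hG : G.Connected) {u : G.L2} (hu : G.tvSeminorm u = 0)
    (hint : G.integralForm u = 0) : u = 0 := by
  refine Lp.eq_zero_iff_ae_eq_zero.2 ((G.ae_vol_iff).2 fun x hx => ?_)
  rw [integralForm_apply, integral_vol,
    Finset.sum_congr rfl fun y _ => by rw [eq_of_TV_eq_zero hG hu y x], ← Finset.sum_mul,
    mul_eq_zero] at hint
  refine hint.resolve_left (ne_of_gt (hx.trans_le ?_))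
  exact Finset.single_le_sum (fun y _ => G.vertexWeight_nonneg y) (Finset.mem_univ x)

theorem exists_norm_le_mul_add (hG : G.Connected) :
    ∃ c, 0 < c ∧ ∀ u : G.L2, ‖u‖ ≤ c * (2 * G.TV u + |∫ x, u x ∂G.vol|) := by
  obtain ⟨c, hc, h⟩ := Seminorm.exists_norm_le_mul
    ((2 : NNReal) • G.tvSeminorm + (normSeminorm ℝ ℝ).comp G.integralForm) (fun u hu => by
      have hu' : 2 * G.tvSeminorm u + |G.integralForm u| = 0 := hu
      have h1 := apply_nonneg G.tvSeminorm u
      have h2 := abs_nonneg (G.integralForm u)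
      exact eq_zero_of_tvSeminorm_eq_zero hG (by linarith) (abs_eq_zero.1 (by linarith)))
  exact ⟨c, hc, h⟩

theorem Connected.poincare_two (hG : G.Connected) :
    ∃ c : ℝ, 0 < c ∧ ∀ u : V → ℝ, eLpNorm u 2 G.vol ≤
      ENNReal.ofReal (c * (2 * G.TV u + |∫ x, u x ∂G.vol|)) := by
  obtain ⟨c, hc, h⟩ := exists_norm_le_mul_add hG
  refine ⟨c, hc, fun u => ?_⟩
  have hu : MemLp u 2 G.vol := .of_discrete
  have h1 := h (hu.toLp u)
  rw [G.TV_congr_ae hu.coeFn_toLp, integral_congr_ae hu.coeFn_toLp] at h1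
  rw [← Lp.enorm_toLp hu, ← ofReal_norm]
  exact ENNReal.ofReal_le_ofReal h1

theorem Connected.poincareInequality_two (hG : G.Connected) : G.PoincareInequality 2 := by
  obtain ⟨c, hc, h⟩ := hG.poincare_two
  refine ⟨c, hc, fun u _ => ?_⟩
  rw [integral_integral_abs_sub_eq_two_mul_TV]
  exact h u

theorem Connected.poincareConst_two_pos (hG : G.Connected) : 0 < G.poincareConst 2 := by
  obtain ⟨c, hc, h⟩ := hG.poincare_two
  refine (ENNReal.ofReal_pos.2 (by positivity : 0 < (c * 2)⁻¹)).trans_le ?_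
  refine le_iInf fun u => le_iInf fun hu => le_iInf fun hne => le_iInf fun hint => ?_
  rw [ENNReal.le_div_iff_mul_le (Or.inl hne) (Or.inl hu.eLpNorm_ne_top)]
  refine (mul_le_mul_right (h u) _).trans ?_
  rw [hint, abs_zero, add_zero, ← ENNReal.ofReal_mul (by positivity)]
  refine ENNReal.ofReal_le_ofReal (le_of_eq ?_)
  field_simp

theorem poincareConst_mul_enorm_le {u : G.L2} (hint : G.integralForm u = 0) (hu : u ≠ 0) :
    G.poincareConst 2 * ‖u‖ₑ ≤ ENNReal.ofReal (G.TV u) := by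
  have hn : eLpNorm u 2 G.vol = ‖u‖ₑ := (Lp.enorm_def u).symm
  have h1 : G.poincareConst 2 ≤ ENNReal.ofReal (G.TV u) / eLpNorm u 2 G.vol :=
    iInf_le_of_le u (iInf_le_of_le (Lp.memLp u) (iInf_le_of_le (by simpa [hn] using hu)
      (iInf_le_of_le hint le_rfl)))
  rw [hn] at h1
  exact (ENNReal.le_div_iff_mul_le (Or.inl (by simpa using hu)) (Or.inl enorm_ne_top)).1 h1

theorem inner_const_eq_zero_of_neg_mem {u v : G.L2} (h : -v ∈ subdifferential G.tvSeminorm u)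
    (c : ℝ) : inner ℝ v (Lp.const 2 G.vol c) = 0 := by
  have h1 := (G.tvSeminorm.mem_subdifferential_iff.1 h).1
  have h2 := h1 (Lp.const 2 G.vol c)
  have h3 := h1 (-Lp.const 2 G.vol c)
  rw [map_neg_eq_map] at h3
  rw [tvSeminorm_const] at h2 h3
  rw [inner_neg_left] at h2
  rw [inner_neg_neg] at h3
  linarith

theorem tvSeminorm_sub_mean (u v : G.L2) : G.tvSeminorm (u - G.mean v) = G.tvSeminorm u := by
  have h := abs_sub_map_le_sub G.tvSeminorm (u - G.mean v) u
  rw [sub_sub_cancel_left, map_neg_eq_map, mean, tvSeminorm_const] at h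
  exact sub_eq_zero.1 (abs_eq_zero.1 (le_antisymm h (abs_nonneg _)))

theorem enorm_sub_mean_le (hG : G.Connected) {u u' : ℝ → G.L2} {t : ℝ} (ht : 0 ≤ t)
    (hu : HasW11Deriv t u u')
    (hu' : ∀ᵐ s ∂(volume.restrict (Ioo 0 t)), -u' s ∈ subdifferential G.tvSeminorm (u s)) :
    ‖u t - G.mean (u 0)‖ₑ ≤ G.poincareConst 2 *
      (‖u 0 - G.mean (u 0)‖ₑ / G.poincareConst 2 - ENNReal.ofReal t) := by
  have hint : ∀ s ∈ Icc 0 t, G.integralForm (u s - G.mean (u 0)) = 0 := by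
    intro s hs
    have := hu.inner_eq_of_inner_eq_zero (w := Lp.const 2 G.vol (1 : ℝ)) (by
      filter_upwards [hu'] with r hr
      rw [real_inner_comm]
      exact inner_const_eq_zero_of_neg_mem hr 1) hs
    rw [inner_const_one, inner_const_one] at this
    rw [map_sub, integralForm_mean, this, sub_self]
  -- An infinite constant leaves `0` as the only mean-zero class.
  by_cases htop : G.poincareConst 2 = ⊤
  · have : u t - G.mean (u 0) = 0 := by
      by_contra hne
      have := poincareConst_mul_enorm_le (hint t ⟨ht, le_rfl⟩) hne
      rw [htop, ENNReal.top_mul (by simpa using hne)] at this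
      exact ENNReal.ofReal_ne_top (top_le_iff.1 this)
    rw [this, enorm_zero]
    exact zero_le
  have hpos := hG.poincareConst_two_pos
  set l := (G.poincareConst 2).toReal with hl
  have hlof : ENNReal.ofReal l = G.poincareConst 2 := ENNReal.ofReal_toReal htop
  have hl0 : 0 ≤ l := ENNReal.toReal_nonneg
  have key : ‖u t - G.mean (u 0)‖ ≤ max (‖u 0 - G.mean (u 0)‖ - l * t) 0 := by
    refine (hu.sub_const (G.mean (u 0))).norm_le_max_of_inner_le ht hl0 ?_
    filter_upwards [hu', ae_restrict_mem measurableSet_Ioo] with s hs hmem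
    have h1 := (G.tvSeminorm.mem_subdifferential_iff.1 hs).2
    rw [inner_neg_left] at h1
    have h2 : l * ‖u s - G.mean (u 0)‖ ≤ G.tvSeminorm (u s - G.mean (u 0)) := by
      by_cases hne : u s - G.mean (u 0) = 0
      · simp [hne]
      have := poincareConst_mul_enorm_le (hint s (Ioo_subset_Icc_self hmem)) hne
      rw [← hlof, ← ofReal_norm, ← ENNReal.ofReal_mul hl0] at this
      exact (ENNReal.ofReal_le_ofReal_iff (G.TV_nonneg _)).1 this
    rw [tvSeminorm_sub_mean] at h2
    rw [inner_sub_right, mean, inner_const_eq_zero_of_neg_mem hs]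
    rw [mean] at h2
    linarith
  rw [ENNReal.mul_sub fun _ _ => htop, ENNReal.mul_div_cancel hpos.ne' htop, ← hlof,
    ← ENNReal.ofReal_mul hl0, ← ofReal_norm, ← ofReal_norm, ← ENNReal.ofReal_sub _ (by positivity)]
  refine (ENNReal.ofReal_le_ofReal key).trans ?_
  simp [ENNReal.ofReal_max]

end WeightedGraph

theorem theorem4p10 {V : Type*} [Fintype V] [MeasurableSpace V] [DiscreteMeasurableSpace V]
    (G : WeightedGraph V) (hG : G.Connected) :
    -- the `2`-Poincaré inequality
    G.PoincareInequality 2 ∧ 0 < G.poincareConst 2 ∧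
    -- the total variation flow `u(t) = e^{tΔ₁}u₀`, i.e. the unique solution of the Cauchy problem
    ∀ u₀ : G.L2, ∃ u : ℝ → G.L2,
      (∀ T : ℝ, 0 < T → G.IsTVFlowOn u₀ T u) ∧
      (∀ T : ℝ, 0 < T → ∀ v : ℝ → G.L2, G.IsTVFlowOn u₀ T v → Set.EqOn v u (Set.Icc 0 T)) ∧
      -- decay and extinction; `-` in `[0, ∞]` is the positive part of the difference
      (∀ t : ℝ, 0 ≤ t →
        ‖u t - G.mean u₀‖ₑ ≤
          G.poincareConst 2 * (‖u₀ - G.mean u₀‖ₑ / G.poincareConst 2 - ENNReal.ofReal t)) ∧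
      (∀ t : ℝ, 0 ≤ t → ‖u₀ - G.mean u₀‖ₑ / G.poincareConst 2 ≤ ENNReal.ofReal t →
        u t = G.mean u₀) := by
  refine ⟨hG.poincareInequality_two, hG.poincareConst_two_pos, fun u₀ => ?_⟩
  obtain ⟨u, u', rfl, hu⟩ := G.tvSeminorm.exists_gradientFlow u₀
  have hdecay : ∀ t : ℝ, 0 ≤ t → ‖u t - G.mean (u 0)‖ₑ ≤
      G.poincareConst 2 * (‖u 0 - G.mean (u 0)‖ₑ / G.poincareConst 2 - ENNReal.ofReal t) := by
    intro t ht
    -- The flow property needs a positive horizon, and `t = 0` is allowed.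
    obtain ⟨h1, h2⟩ := hu (t + 1) (by linarith)
    exact WeightedGraph.enorm_sub_mean_le hG ht (h1.mono ht (by linarith))
      (ae_restrict_of_ae_restrict_of_subset (Ioo_subset_Ioo_right (by linarith)) h2)
  refine ⟨u, fun T hT => ⟨rfl, u', hu T hT⟩, fun T hT v hv => ?_, hdecay, fun t ht hle => ?_⟩
  · obtain ⟨hv0, v', hv1, hv2⟩ := hv
    exact hv1.eqOn_of_neg_mem_subdifferential (F := G.tvSeminorm) (hu T hT).1 hv2 (hu T hT).2 hv0
  · have := hdecay t ht
    rw [tsub_eq_zero_of_le hle, mul_zero, nonpos_iff_eq_zero, enorm_eq_zero, sub_eq_zero] at this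
    exact this
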